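/- For $m\in\mathbb N$, $m\ge1$, and $s>0$ let $$A_m(s)=\bigl(I_m-\tfrac s2T_m\bigr)^{-1}\bigl(I_m+\tfrac s2T_m\bigr),\qquad T_m=\mathrm{tridiag}(1,-2,1)\in\mathbb R^{m\times m},$$ be the Crank--Nicolson iteration matrix for the heat equation with CFL coefficient $s=\tau/h^2$ (time step $\tau$, mesh width $h$); thus the inverted matrix has diagonal entries $1+s$ and sub- and superdiagonal entries $-s/2$, and the second factor has diagonal entries $1-s$ and sub- and superdiagonal entries $s/2$. Let $\|A\|_\infty=\max_i\sum_j|a_{ij}|$. Call $A_m(s)$ contractive if $\|A_m(s)\|_\infty\le1$. 1. For $m\in\{1,2,3\}$, $\|A_m(s)\|_\infty\le 1$ for every $s>0$. 2. For every integer $m\ge4$ and every $s>0$, $$\|A_m(s)\|_\infty\le1\iff s\le s_m^{(c)}:=\frac1{\cosh\omega_m^{(c)}-1},$$ where $\omega_m^{(c)}\in\Bigl[\log\frac{3+\sqrt5+\sqrt{-2+6\sqrt5}}4,\ \log3\Bigr)$ is the unique positive root $\omega$ of the equation $$2\sinh\tfrac{(m-1)\omega}4\,\sinh\tfrac{(m+1)\omega}4=\sinh\tfrac\omega2\,\sinh\tfrac{(m+1)\omega}2$$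 if $m$ is odd, and of the equation $$\sinh^2\!\bigl(\tfrac\omega2\bigr)\,\sinh\tfrac{m\omega}2\Bigl(\sinh\tfrac{(m+2)\omega}2-\sinh\tfrac{m\omega}2\Bigr)=\sinh\omega\,\sinh\tfrac{(m+1)\omega}2\,\sinh\tfrac{m\omega}4\,\sinh\tfrac{(m-2)\omega}4$$ if $m$ is even. 3. The sequence $(s_m^{(c)})_{m\ge4}$ is strictly decreasing, all its terms lie in $\bigl(\tfrac32,\,1+\sqrt5\,\bigr]$, and $\lim_{m\to\infty}s_m^{(c)}=\tfrac32$. Consequently contractivity is not preserved when the spatial mesh is refined with $s$ kept constant: for every $m\ge4$ there is an $s>0$ such that $\|A_m(s)\|_\infty\le1$ but $\|A_n(s)\|_\infty>1$ for all $n>m$. -/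

import Mathlib

open Real Set Filter Topology

/-- The `m × m` tridiagonal Toeplitz matrix with `a` on the subdiagonal, `b` on the diagonal and
`c` on the superdiagonal. -/
def tridiag (m : ℕ) (a b c : ℝ) : Matrix (Fin m) (Fin m) ℝ :=
  Matrix.of fun i j =>
    if (i : ℕ) = j then b
    else if (i : ℕ) = (j : ℕ) + 1 then a
    else if (j : ℕ) = (i : ℕ) + 1 then c
    else 0

/-- The Crank–Nicolson iteration matrix `A_m(s) = (I - (s/2) T)⁻¹ (I + (s/2) T)` of dimension `m`
for the heat equation, where `T = tridiag(1, -2, 1)` and `s = τ / h²` is the CFL coefficient. For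
`s > 0` the matrix that is inverted is strictly diagonally dominant, hence invertible. -/
noncomputable def crankNicolson (m : ℕ) (s : ℝ) : Matrix (Fin m) (Fin m) ℝ :=
  (tridiag m (-(s / 2)) (1 + s) (-(s / 2)))⁻¹ * tridiag m (s / 2) (1 - s) (s / 2)

/-- The maximum norm `‖A‖_∞ = max_i ∑_j |a_ij|`, i.e. the matrix norm subordinate to the sup norm. -/
noncomputable def maxNorm {m : ℕ} (A : Matrix (Fin m) (Fin m) ℝ) : ℝ :=
  letI := Matrix.linftyOpNormedAddCommGroup (m := Fin m) (n := Fin m) (α := ℝ)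
  ‖A‖

/-- The equation, in the unknown `w`, that determines the contractivity bound for odd `m`. -/
def OddEquation (m : ℕ) (w : ℝ) : Prop :=
  2 * sinh (((m : ℝ) - 1) * w / 4) * sinh (((m : ℝ) + 1) * w / 4)
    = sinh (w / 2) * sinh (((m : ℝ) + 1) * w / 2)

/-- The equation, in the unknown `w`, that determines the contractivity bound for even `m`. -/
def EvenEquation (m : ℕ) (w : ℝ) : Prop :=
  sinh (w / 2) ^ 2 * sinh ((m : ℝ) * w / 2)
      * (sinh (((m : ℝ) + 2) * w / 2) - sinh ((m : ℝ) * w / 2))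
    = sinh w * sinh (((m : ℝ) + 1) * w / 2) * sinh ((m : ℝ) * w / 4)
      * sinh (((m : ℝ) - 2) * w / 4)

/-- The equation for `m`: one for odd `m`, another for even `m`. -/
def ContractivityEquation (m : ℕ) (w : ℝ) : Prop :=
  (Odd m → OddEquation m w) ∧ (Even m → EvenEquation m w)

/-!
Write `1 / s = cosh w - 1`, `x = w / 2`, `N = m + 1`. The two factors of `A = crankNicolson m s` add
up to `2 I`, so `A = 2 G - I`, where `G` is the inverse of the first factor. It is explicit: a
discrete Green function (`green`) with nonnegative entries, whose row sums are less than one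
(`sum_green`). Hence the `i`-th absolute row sum of `A` is at most one if and only if the `i`-th row
sum of `G` is at most `2 G i i` (`sum_abs_crankNicolson_le_one_iff`), and the addition theorems turn
this into
`tanh (i x) + tanh ((N - i) x) ≤ 4 tanh x`, with rows counted from one (`sum_green_le_iff`).

For a fixed sum of the arguments the left side is largest when they are balanced, so only the middle
row matters: contractivity is the inequality `midTanh N x ≤ 4 tanh x`
(`maxNorm_crankNicolson_le_one_iff`). The case of equality is equivalent to the
contractivity equation for `w` (`contractivityEquation_iff`).

The rest follows from two monotonicity properties: `midTanh N x` increases with `N`, and for `N ≥ 4`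
the quotient `midTanh N x / tanh x` decreases in `x` (`midTanh_mul_tanh_lt`, by induction from the
addition theorem). The second gives uniqueness of the root and the threshold, the first its
monotonicity in `m` and the cases `m ≤ 3`. Existence follows from the intermediate value theorem
between the root for `N = 5`, which is explicit, and `log 3 / 2`, where `tanh = 1 / 2`
(`exists_critical`). As `N → ∞`, `midTanh N` tends to `2` at the root, so `tanh x → 1 / 2` there,
which is `s → 3 / 2`.
-/

/-! ### The hyperbolic tangent -/

theorem strictMono_tanh : StrictMono tanh := fun x y hxy => by
  have hmem (z : ℝ) : tanh z ∈ Ioo (-1 : ℝ) 1 := ⟨neg_one_lt_tanh z, tanh_lt_one z⟩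
  rw [← artanh_lt_artanh_iff (hmem x) (hmem y), artanh_tanh, artanh_tanh]
  exact hxy

theorem tanh_pos_of_pos {x : ℝ} (hx : 0 < x) : 0 < tanh x := by
  simpa using strictMono_tanh hx

theorem continuous_tanh_real : Continuous tanh := by
  have h : tanh = fun x => sinh x / cosh x := funext tanh_eq_sinh_div_cosh
  rw [h]
  exact continuous_sinh.div continuous_cosh fun x => (cosh_pos x).ne'

theorem tendsto_tanh_atTop_one : Tendsto tanh atTop (𝓝 1) := by
  refine tendsto_order.2 ⟨fun a ha => ?_, fun a ha => .of_forall fun x => (tanh_lt_one x).trans ha⟩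
  have hb : max a 0 ∈ Ioo (-1 : ℝ) 1 := ⟨lt_max_of_lt_right (by norm_num), max_lt ha one_pos⟩
  filter_upwards [eventually_gt_atTop (artanh (max a 0))] with x hx
  calc a ≤ max a 0 := le_max_left _ _
    _ = tanh (artanh (max a 0)) := (tanh_artanh hb).symm
    _ < tanh x := strictMono_tanh hx

theorem tanh_add_eq_div (x y : ℝ) :
    tanh (x + y) = (tanh x + tanh y) / (1 + tanh x * tanh y) := by
  have hx := cosh_pos x
  have hy := cosh_pos y
  have hxy := cosh_pos (x + y)
  have h : 1 + tanh x * tanh y = cosh (x + y) / (cosh x * cosh y) := by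
    rw [cosh_add, tanh_eq_sinh_div_cosh, tanh_eq_sinh_div_cosh]
    field_simp
  rw [h, tanh_eq_sinh_div_cosh, tanh_eq_sinh_div_cosh, tanh_eq_sinh_div_cosh, sinh_add]
  field_simp

theorem tanh_add_tanh (p q : ℝ) :
    tanh p + tanh q = 2 * sinh (p + q) / (cosh (p + q) + cosh (p - q)) := by
  have hp := cosh_pos p
  have hq := cosh_pos q
  have h : cosh (p + q) + cosh (p - q) = 2 * (cosh p * cosh q) := by
    rw [cosh_add, cosh_sub]; ring
  rw [h, sinh_add, tanh_eq_sinh_div_cosh, tanh_eq_sinh_div_cosh]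
  field_simp

/-- With a fixed nonnegative sum of the arguments, `tanh p + tanh q` grows as `p` and `q` get
closer. -/
theorem tanh_add_tanh_le {p q p' q' : ℝ} (hsum : p + q = p' + q') (hpos : 0 ≤ p' + q')
    (hdiff : |p' - q'| ≤ |p - q|) : tanh p + tanh q ≤ tanh p' + tanh q' := by
  rw [tanh_add_tanh, tanh_add_tanh, hsum]
  have h1 := cosh_le_cosh.2 hdiff
  have h2 := cosh_pos (p' + q')
  have h3 := cosh_pos (p' - q')
  have h4 := sinh_nonneg_iff.2 hpos
  gcongr

/-- The quotient `tanh (k x) / tanh x` decreases in `x > 0`; cross-multiplied form. -/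
theorem tanh_mul_tanh_le {x y : ℝ} (hx : 0 < x) (hxy : x < y) (k : ℕ) :
    tanh (k * y) * tanh x ≤ tanh (k * x) * tanh y ∧
      (2 ≤ k → tanh (k * y) * tanh x < tanh (k * x) * tanh y) := by
  induction k with
  | zero => simp
  | succ k ih =>
    rcases Nat.eq_zero_or_pos k with rfl | hk
    · simp [mul_comm]
    suffices h : tanh ((k + 1 : ℕ) * y) * tanh x < tanh ((k + 1 : ℕ) * x) * tanh y from
      ⟨h.le, fun _ => h⟩
    have hkR : (0 : ℝ) < k := by exact_mod_cast hk
    have hT := tanh_pos_of_pos hx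
    have hTU := strictMono_tanh hxy
    have ha := tanh_pos_of_pos (mul_pos hkR hx)
    have hab : tanh (k * x) < tanh (k * y) := strictMono_tanh (by gcongr)
    have hih := ih.1
    push_cast
    rw [add_mul, add_mul, one_mul, one_mul, tanh_add_eq_div, tanh_add_eq_div]
    generalize tanh x = T at *
    generalize tanh y = U at *
    generalize tanh (k * x) = a at *
    generalize tanh (k * y) = b at *
    have hU : 0 < U := hT.trans hTU
    have hb : 0 < b := ha.trans hab
    rw [div_mul_eq_mul_div, div_mul_eq_mul_div, div_lt_div_iff₀ (by positivity) (by positivity)]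
    have h1 : a * T < b * U := mul_lt_mul hab hTU.le hT hb.le
    have h2 : 0 < T * U * (b * U - a * T) := mul_pos (mul_pos hT hU) (by linarith)
    have h3 : 0 < a * b * (U - T) * (U + T) :=
      mul_pos (mul_pos (mul_pos ha hb) (by linarith)) (by linarith)
    -- The difference of the two sides is `h2 + h3 + (a U - b T)`.
    linarith

/-! ### The two middle arguments -/

/-- The sum `tanh p + tanh q` for the most balanced splitting `p + q = N x` into integer multiples
of `x`. -/
noncomputable def midTanh (N : ℕ) (x : ℝ) : ℝ :=
  tanh ((N / 2 : ℕ) * x) + tanh (((N + 1) / 2 : ℕ) * x)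

theorem strictMono_midTanh {x : ℝ} (hx : 0 < x) : StrictMono fun N => midTanh N x := by
  refine strictMono_nat_of_lt_succ fun N => ?_
  have h : (N + 1 + 1) / 2 = N / 2 + 1 := by omega
  have hlt : tanh ((N / 2 : ℕ) * x) < tanh ((N / 2 + 1 : ℕ) * x) :=
    strictMono_tanh (by push_cast; linarith)
  simp only [midTanh, h]
  linarith

/-- The quotient `midTanh N x / tanh x` decreases strictly in `x > 0`; cross-multiplied form. -/
theorem midTanh_mul_tanh_lt {N : ℕ} (hN : 4 ≤ N) {x y : ℝ} (hx : 0 < x) (hxy : x < y) :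
    midTanh N y * tanh x < midTanh N x * tanh y := by
  have h1 := (tanh_mul_tanh_le hx hxy (N / 2)).2 (by omega)
  have h2 := (tanh_mul_tanh_le hx hxy ((N + 1) / 2)).2 (by omega)
  simp only [midTanh]
  linarith

theorem continuous_midTanh (N : ℕ) : Continuous (midTanh N) :=
  (continuous_tanh_real.comp (continuous_const_mul _)).add
    (continuous_tanh_real.comp (continuous_const_mul _))

theorem midTanh_lt_two (N : ℕ) (x : ℝ) : midTanh N x < 2 := by
  have h1 := tanh_lt_one ((N / 2 : ℕ) * x)
  have h2 := tanh_lt_one (((N + 1) / 2 : ℕ) * x)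
  simp only [midTanh]
  linarith

theorem two_mul_tanh_le_midTanh (N : ℕ) {x : ℝ} (hx : 0 ≤ x) :
    2 * tanh ((N / 2 : ℕ) * x) ≤ midTanh N x := by
  have h : tanh ((N / 2 : ℕ) * x) ≤ tanh (((N + 1) / 2 : ℕ) * x) :=
    strictMono_tanh.monotone (by gcongr; omega)
  simp only [midTanh]
  linarith

/-- No splitting of `N x` into integer multiples `i x` and `j x` beats the balanced one. -/
theorem tanh_add_tanh_le_midTanh {N i j : ℕ} (h : i + j = N) {x : ℝ} (hx : 0 ≤ x) :
    tanh (i * x) + tanh (j * x) ≤ midTanh N x := by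
  have hN : N / 2 + (N + 1) / 2 = N := by omega
  have hN' : ((N / 2 : ℕ) : ℝ) + ((N + 1) / 2 : ℕ) = N := by exact_mod_cast hN
  have h' : (i : ℝ) + j = N := by exact_mod_cast h
  refine tanh_add_tanh_le (by rw [← add_mul, ← add_mul, h', hN']) (by positivity) ?_
  rw [← sub_mul, ← sub_mul, abs_mul, abs_mul]
  refine mul_le_mul_of_nonneg_right ?_ (abs_nonneg x)
  have hz : |((N / 2 : ℕ) : ℤ) - ((N + 1) / 2 : ℕ)| ≤ |(i : ℤ) - j| := by
    rcases abs_cases (((N / 2 : ℕ) : ℤ) - ((N + 1) / 2 : ℕ)) with h1 | h1 <;>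
      rcases abs_cases ((i : ℤ) - j) with h2 | h2 <;> omega
  exact_mod_cast hz

theorem midTanh_le_of_le_four {N : ℕ} (hN : N ≤ 4) {x : ℝ} (hx : 0 < x) :
    midTanh N x ≤ 4 * tanh x := by
  refine ((strictMono_midTanh hx).monotone hN).trans ?_
  have hT := tanh_pos_of_pos hx
  have h2 : tanh (2 * x) ≤ 2 * tanh x := by
    rw [two_mul x, tanh_add_eq_div, div_le_iff₀ (by positivity)]
    nlinarith [mul_pos hT (mul_pos hT hT)]
  norm_num [midTanh]
  linarith

/-! ### The critical value -/

/-- `ω₄`, the critical value in dimension four, which is the lower end of the interval that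
contains all critical values. -/
noncomputable def criticalFour : ℝ := log ((3 + √5 + √(-2 + 6 * √5)) / 4)

theorem two_lt_sqrt_five : 2 < √5 := by
  rw [lt_sqrt (by norm_num)]; norm_num

theorem criticalFour_pos : 0 < criticalFour := by
  refine log_pos ?_
  have := sqrt_nonneg (-2 + 6 * √5)
  linarith [two_lt_sqrt_five]

/-- The argument of the logarithm is `c + √(c ^ 2 - 1)` with `c = (3 + √5) / 4`. -/
theorem cosh_criticalFour : cosh criticalFour = (3 + √5) / 4 := by
  have h5 : √5 ^ 2 = 5 := sq_sqrt (by norm_num)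
  have hr : √(-2 + 6 * √5) ^ 2 = -2 + 6 * √5 := sq_sqrt (by linarith [two_lt_sqrt_five])
  have hpos : 0 < (3 + √5 + √(-2 + 6 * √5)) / 4 := by
    linarith [two_lt_sqrt_five, sqrt_nonneg (-2 + 6 * √5)]
  rw [criticalFour, cosh_log hpos]
  generalize √(-2 + 6 * √5) = r at *
  have hne : 3 + √5 + r ≠ 0 := fun h => by simp [h] at hpos
  field_simp
  linear_combination hr - h5

/-- The equation for `N = 5` is quadratic in `cosh w`, where `w = 2 x`; this makes the critical value
in dimension four explicit. -/
theorem midTanh_five_eq_iff {x : ℝ} (hx : 0 < x) :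
    midTanh 5 x = 4 * tanh x ↔ 4 * cosh (2 * x) ^ 2 - 6 * cosh (2 * x) + 1 = 0 := by
  have hc := cosh_pos x
  have hs : 0 < sinh x := sinh_pos_iff.2 hx
  have hsq := cosh_sq x
  have hT : tanh x = sinh x / cosh x := tanh_eq_sinh_div_cosh x
  have h2 : tanh (2 * x) = sinh (2 * x) / cosh (2 * x) := tanh_eq_sinh_div_cosh _
  have h3 : tanh (3 * x) = sinh (3 * x) / cosh (3 * x) := tanh_eq_sinh_div_cosh _
  have hc2 := cosh_pos (2 * x)
  have hc2' : cosh (2 * x) = 1 + 2 * sinh x ^ 2 := by rw [cosh_two_mul, hsq]; ring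
  have hs2' : sinh (2 * x) = 2 * sinh x * cosh x := sinh_two_mul x
  have hc3' : cosh (3 * x) = cosh x * (1 + 4 * sinh x ^ 2) := by
    rw [cosh_three_mul]; linear_combination 4 * cosh x * hsq
  have hs3' : sinh (3 * x) = sinh x * (4 * sinh x ^ 2 + 3) := by rw [sinh_three_mul]; ring
  have hmid : midTanh 5 x = tanh (2 * x) + tanh (3 * x) := by norm_num [midTanh]
  have hkey : midTanh 5 x - 4 * tanh x =
      -(sinh x / (cosh x * cosh (2 * x) * (1 + 4 * sinh x ^ 2))) *
        (4 * cosh (2 * x) ^ 2 - 6 * cosh (2 * x) + 1) := by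
    rw [hmid, hT, h2, h3, hs2', hc3', hs3', hc2']
    field_simp
    linear_combination (2 + 8 * sinh x ^ 2) * hsq
  rw [← sub_eq_zero, hkey, mul_eq_zero]
  have : sinh x / (cosh x * cosh (2 * x) * (1 + 4 * sinh x ^ 2)) ≠ 0 := by positivity
  simp [this]

theorem midTanh_five_criticalFour :
    midTanh 5 (criticalFour / 2) = 4 * tanh (criticalFour / 2) := by
  rw [midTanh_five_eq_iff (half_pos criticalFour_pos), mul_div_cancel₀ _ (two_ne_zero (α := ℝ)),
    cosh_criticalFour]
  have h5 : √5 ^ 2 = 5 := sq_sqrt (by norm_num)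
  linear_combination h5 / 4

theorem cosh_log_three : cosh (log 3) = 5 / 3 := by
  rw [cosh_log (by norm_num)]; norm_num

theorem criticalFour_lt_log_three : criticalFour < log 3 := by
  have h : cosh criticalFour < cosh (log 3) := by
    rw [cosh_log_three, cosh_criticalFour]
    have : √5 < 11 / 3 := (sqrt_lt' (by norm_num)).2 (by norm_num)
    linarith
  rwa [cosh_lt_cosh, abs_of_pos criticalFour_pos, abs_of_pos (log_pos (by norm_num))] at h

theorem tanh_log_three_div_two : tanh (log 3 / 2) = 1 / 2 := by
  have hc := cosh_pos (log 3 / 2)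
  have hsq := cosh_sq (log 3 / 2)
  have h2 : cosh (log 3) = cosh (log 3 / 2) ^ 2 + sinh (log 3 / 2) ^ 2 := by
    rw [← cosh_two_mul]; congr 1; ring
  rw [cosh_log_three] at h2
  have hs : 0 < sinh (log 3 / 2) := sinh_pos_iff.2 (half_pos (log_pos (by norm_num)))
  have h3 : (2 * sinh (log 3 / 2)) ^ 2 = cosh (log 3 / 2) ^ 2 := by linarith
  have h4 : 2 * sinh (log 3 / 2) = cosh (log 3 / 2) :=
    (pow_left_inj₀ (by positivity) hc.le two_ne_zero).1 h3
  rw [tanh_eq_sinh_div_cosh, ← h4]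
  field_simp

/-- The critical value exists: at `criticalFour / 2` the balanced sum is at least `4 tanh x`, by
monotonicity in `N`, and at `log 3 / 2` it is less. -/
theorem exists_critical {N : ℕ} (hN : 5 ≤ N) :
    ∃ x ∈ Ico (criticalFour / 2) (log 3 / 2), midTanh N x = 4 * tanh x := by
  have hlt : criticalFour / 2 < log 3 / 2 := by linarith [criticalFour_lt_log_three]
  have hcont : ContinuousOn (fun x => midTanh N x - 4 * tanh x)
      (Icc (criticalFour / 2) (log 3 / 2)) :=
    ((continuous_midTanh N).sub (continuous_const.mul continuous_tanh_real)).continuousOn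
  have hlow : 0 ≤ midTanh N (criticalFour / 2) - 4 * tanh (criticalFour / 2) := by
    rw [← midTanh_five_criticalFour, sub_nonneg]
    exact (strictMono_midTanh (half_pos criticalFour_pos)).monotone hN
  have hhigh : midTanh N (log 3 / 2) - 4 * tanh (log 3 / 2) < 0 := by
    rw [tanh_log_three_div_two]
    linarith [midTanh_lt_two N (log 3 / 2)]
  obtain ⟨x, hx, hx0⟩ := intermediate_value_Icc' hlt.le hcont ⟨hhigh.le, hlow⟩
  refine ⟨x, ⟨hx.1, lt_of_le_of_ne hx.2 ?_⟩, sub_eq_zero.1 hx0⟩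
  rintro rfl
  exact hhigh.ne hx0

/-- Beyond the critical value, and only there, the balanced sum is at most `4 tanh x`. -/
theorem midTanh_le_iff {N : ℕ} (hN : 4 ≤ N) {x c : ℝ} (hx : 0 < x) (hc : 0 < c)
    (hroot : midTanh N c = 4 * tanh c) : midTanh N x ≤ 4 * tanh x ↔ c ≤ x := by
  have hTc := tanh_pos_of_pos hc
  refine ⟨fun h => ?_, fun h => ?_⟩
  · by_contra! hlt
    have := midTanh_mul_tanh_lt hN hx hlt
    rw [hroot] at this
    nlinarith
  · rcases h.eq_or_lt with rfl | hlt
    · exact hroot.le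
    have := midTanh_mul_tanh_lt hN hc hlt
    rw [hroot] at this
    nlinarith

theorem eq_critical {N : ℕ} (hN : 4 ≤ N) {x c : ℝ} (hx : 0 < x) (hc : 0 < c)
    (hroot : midTanh N c = 4 * tanh c) (h : midTanh N x = 4 * tanh x) : x = c :=
  le_antisymm ((midTanh_le_iff hN hc hx h).1 hroot.le) ((midTanh_le_iff hN hx hc hroot).1 h.le)

theorem critical_lt_critical {N N' : ℕ} (hN : 4 ≤ N) (hNN : N < N') {c c' : ℝ} (hc : 0 < c)
    (hc' : 0 < c') (hroot : midTanh N c = 4 * tanh c) (hroot' : midTanh N' c' = 4 * tanh c') :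
    c < c' := by
  by_contra! hle
  have h1 := (midTanh_le_iff (hN.trans hNN.le) hc hc' hroot').2 hle
  exact (h1.trans hroot.ge).not_gt (strictMono_midTanh hc hNN)

/-! ### The equation for the critical value -/

/-- With `y = (j + 1) x` the equation reads `sinh (y - x) = sinh x cosh y`, that is,
`tanh y = 2 tanh x`. -/
theorem oddEquation_iff {j : ℕ} {w : ℝ} (hw : 0 < w) :
    OddEquation (2 * j + 1) w ↔ midTanh (2 * j + 2) (w / 2) = 4 * tanh (w / 2) := by
  have e1 : (2 * j + 2) / 2 = j + 1 := by omega
  have e2 : (2 * j + 2 + 1) / 2 = j + 1 := by omega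
  have hy : 0 < (j + 1 : ℝ) * (w / 2) := by positivity
  have a1 : ((2 * j + 1 : ℕ) - 1 : ℝ) * w / 4 = (j + 1 : ℝ) * (w / 2) - w / 2 := by
    push_cast; ring
  have a2 : ((2 * j + 1 : ℕ) + 1 : ℝ) * w / 4 = (j + 1 : ℝ) * (w / 2) := by push_cast; ring
  have a3 : ((2 * j + 1 : ℕ) + 1 : ℝ) * w / 2 = 2 * ((j + 1 : ℝ) * (w / 2)) := by
    push_cast; ring
  rw [OddEquation, midTanh, e1, e2, a1, a2, a3]
  push_cast
  generalize (j + 1 : ℝ) * (w / 2) = y at *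
  generalize w / 2 = x
  have hs := sinh_pos_iff.2 hy
  have hcy := cosh_pos y
  have hcx := cosh_pos x
  have hkey : 2 * sinh (y - x) * sinh y - sinh x * sinh (2 * y) =
      sinh y * cosh x * cosh y * (tanh y + tanh y - 4 * tanh x) := by
    rw [sinh_sub, sinh_two_mul, tanh_eq_sinh_div_cosh, tanh_eq_sinh_div_cosh]
    field_simp
    ring
  rw [← sub_eq_zero, hkey, mul_eq_zero, ← sub_eq_zero (b := 4 * tanh x)]
  have : sinh y * cosh x * cosh y ≠ 0 := by positivity
  simp [this]

/-- The two sides of the equation differ by a nonvanishing multiple of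
`tanh p + tanh (p + x) - 4 tanh x`, where `p = k x`. -/
theorem evenEquation_iff {k : ℕ} (hk : 0 < k) {w : ℝ} (hw : 0 < w) :
    EvenEquation (2 * k) w ↔ midTanh (2 * k + 1) (w / 2) = 4 * tanh (w / 2) := by
  have e1 : (2 * k + 1) / 2 = k := by omega
  have e2 : (2 * k + 1 + 1) / 2 = k + 1 := by omega
  have hkR : (0 : ℝ) < k := by exact_mod_cast hk
  have hp : 0 < (k : ℝ) * (w / 2) := by positivity
  have hx : 0 < w / 2 := by positivity
  have a1 : ((2 * k : ℕ) : ℝ) * w / 2 = 2 * (k * (w / 2)) := by push_cast; ring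
  have a2 : ((2 * k : ℕ) + 2 : ℝ) * w / 2 = 2 * (k * (w / 2)) + 2 * (w / 2) := by
    push_cast; ring
  have a3 : ((2 * k : ℕ) + 1 : ℝ) * w / 2 = 2 * (k * (w / 2)) + w / 2 := by push_cast; ring
  have a4 : ((2 * k : ℕ) : ℝ) * w / 4 = k * (w / 2) := by push_cast; ring
  have a5 : ((2 * k : ℕ) - 2 : ℝ) * w / 4 = k * (w / 2) - w / 2 := by push_cast; ring
  have a6 : ((k + 1 : ℕ) : ℝ) * (w / 2) = k * (w / 2) + w / 2 := by push_cast; ring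
  have a7 : sinh w = sinh (2 * (w / 2)) := by congr 1; ring
  rw [EvenEquation, midTanh, e1, e2, a1, a2, a3, a4, a5, a6, a7]
  generalize (k : ℝ) * (w / 2) = p at *
  generalize w / 2 = x at *
  have hsp := sinh_pos_iff.2 hp
  have hsx := sinh_pos_iff.2 hx
  have hsq := sinh_pos_iff.2 (add_pos hp hx)
  have hcp := cosh_pos p
  have hcx := cosh_pos x
  have hcq := cosh_pos (p + x)
  have hdiff : sinh (2 * p + 2 * x) - sinh (2 * p) = 2 * cosh (p + (p + x)) * sinh x := by
    -- Written as `(2 p + x) ± x`, the arguments make the terms without `sinh x` cancel.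
    have b1 : 2 * p + 2 * x = (p + (p + x)) + x := by ring
    have b2 : 2 * p = (p + (p + x)) - x := by ring
    rw [b1, b2, sinh_add, sinh_sub]
    ring
  have hsum : 2 * p + x = p + (p + x) := by ring
  have hD : (tanh p + tanh (p + x) - 4 * tanh x) * (cosh p * cosh (p + x) * cosh x) =
      sinh p * cosh (p + x) * cosh x + sinh (p + x) * cosh p * cosh x -
        4 * sinh x * cosh p * cosh (p + x) := by
    rw [tanh_eq_sinh_div_cosh, tanh_eq_sinh_div_cosh, tanh_eq_sinh_div_cosh]
    field_simp
  have hkey : sinh x ^ 2 * sinh (2 * p) * (sinh (2 * p + 2 * x) - sinh (2 * p)) -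
      sinh (2 * x) * sinh (2 * p + x) * sinh p * sinh (p - x) =
      -(2 * sinh p * sinh x * sinh (p + x)) *
        ((tanh p + tanh (p + x) - 4 * tanh x) * (cosh p * cosh (p + x) * cosh x)) := by
    rw [hD, hdiff, hsum, sinh_two_mul, sinh_two_mul, cosh_add p (p + x), sinh_add p (p + x),
      sinh_sub, sinh_add, cosh_add]
    ring
  rw [← sub_eq_zero, hkey, ← sub_eq_zero (b := 4 * tanh x)]
  have h1 : 2 * sinh p * sinh x * sinh (p + x) ≠ 0 := by positivity
  have h2 : cosh p * cosh (p + x) * cosh x ≠ 0 := by positivity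
  rw [neg_mul, neg_eq_zero, mul_eq_zero_iff_left h1, mul_eq_zero_iff_right h2]

theorem contractivityEquation_iff {m : ℕ} (hm : 0 < m) {w : ℝ} (hw : 0 < w) :
    ContractivityEquation m w ↔ midTanh (m + 1) (w / 2) = 4 * tanh (w / 2) := by
  rcases Nat.even_or_odd' m with ⟨k, rfl | rfl⟩
  · have he : Even (2 * k) := even_two_mul k
    simp only [ContractivityEquation, he, Nat.not_odd_iff_even.2 he, false_imp_iff, true_and,
      true_imp_iff]
    exact evenEquation_iff (by omega) hw
  · have ho : Odd (2 * k + 1) := odd_two_mul_add_one k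
    simp only [ContractivityEquation, ho, Nat.not_even_iff_odd.2 ho, false_imp_iff, and_true,
      true_imp_iff]
    exact oddEquation_iff hw

/-! ### The inverse matrix -/

theorem maxNorm_le_one_iff {m : ℕ} (A : Matrix (Fin m) (Fin m) ℝ) :
    maxNorm A ≤ 1 ↔ ∀ i, ∑ j, |A i j| ≤ 1 := by
  have h : maxNorm A = ((Finset.univ : Finset (Fin m)).sup fun i => ∑ j, ‖A i j‖₊ : NNReal) :=
    Matrix.linfty_opNorm_def A
  rw [h, ← NNReal.coe_one, NNReal.coe_le_coe, Finset.sup_le_iff]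
  refine ⟨fun h i => ?_, fun h i _ => ?_⟩
  · have := NNReal.coe_le_coe.2 (h i (Finset.mem_univ i))
    simpa using this
  · rw [← NNReal.coe_le_coe]
    simpa using h i

/-- A tridiagonal Toeplitz matrix acts as a three-term recurrence on a sequence `g` on
`0, …, m + 1` that vanishes at both ends. -/
theorem sum_tridiag_mul {m : ℕ} (a b : ℝ) (g : ℕ → ℝ) (h0 : g 0 = 0) (h1 : g (m + 1) = 0)
    (i : Fin m) :
    ∑ k : Fin m, tridiag m a b a i k * g (k + 1) =
      a * (g i + g (i + 2)) + b * g (i + 1) := by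
  have hterm (k : Fin m) : tridiag m a b a i k * g (k + 1) =
      (if (k : ℕ) = i then b * g (k + 1) else 0) +
      (if (k : ℕ) + 1 = i then a * g (k + 1) else 0) +
      (if (k : ℕ) = i + 1 then a * g (k + 1) else 0) := by
    simp only [tridiag, Matrix.of_apply]
    split_ifs <;> first | omega | simp
  simp only [hterm]
  rw [Fin.sum_univ_eq_sum_range (fun k : ℕ => (if k = i then b * g (k + 1) else 0) +
      (if k + 1 = i then a * g (k + 1) else 0) + (if k = i + 1 then a * g (k + 1) else 0)) m,
    Finset.sum_add_distrib, Finset.sum_add_distrib]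
  have s1 : ∑ k ∈ Finset.range m, (if k = (i : ℕ) then b * g (k + 1) else 0) =
      b * g (i + 1) := by
    simp
  have s2 : ∑ k ∈ Finset.range m, (if k + 1 = (i : ℕ) then a * g (k + 1) else 0) = a * g i := by
    obtain ⟨n, hn⟩ := i
    cases n with
    | zero => simp [h0]
    | succ n =>
      simp only [add_left_inj, Finset.sum_ite_eq', Finset.mem_range, if_pos (show n < m by omega)]
  have s3 : ∑ k ∈ Finset.range m, (if k = (i : ℕ) + 1 then a * g (k + 1) else 0) =
      a * g (i + 2) := by
    rw [Finset.sum_ite_eq']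
    split_ifs with h
    · rfl
    · have : (i : ℕ) + 2 = m + 1 := by have := i.2; simp at h; omega
      rw [this, h1, mul_zero]
  rw [s1, s2, s3]
  ring

/-- The function `n ↦ sinh (min n c · w) sinh ((N - max n c) w)`, which solves the three-term
recurrence `g (n - 1) + g (n + 1) = 2 cosh w · g n` except at `n = c` and vanishes at `0`
and `N`. -/
noncomputable def greenNumerator (N : ℕ) (w : ℝ) (n c : ℕ) : ℝ :=
  if n ≤ c then sinh (n * w) * sinh ((N - c) * w) else sinh (c * w) * sinh ((N - n) * w)

/-- The discrete Green function: the inverse of the matrix `I - (s/2) T` of dimension `m`, where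
`1 / s = cosh w - 1`. Rows and columns, which are counted from zero in `Fin m`, correspond to the
points `1, …, m` of the grid `0, …, m + 1`. -/
noncomputable def green (m : ℕ) (w : ℝ) : Matrix (Fin m) (Fin m) ℝ :=
  Matrix.of fun i j =>
    2 * (cosh w - 1) / (sinh w * sinh ((m + 1) * w)) * greenNumerator (m + 1) w (i + 1) (j + 1)

/-- At `n + 1 = c` the recurrence leaves a constant residue, the Wronskian of the two solutions that
`greenNumerator` is glued from. -/
theorem greenNumerator_recurrence (N : ℕ) (w : ℝ) (n c : ℕ) :
    2 * cosh w * greenNumerator N w (n + 1) c -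
      (greenNumerator N w n c + greenNumerator N w (n + 2) c) =
      if n + 1 = c then sinh w * sinh (N * w) else 0 := by
  have a1 : ((n + 1 : ℕ) : ℝ) * w = n * w + w := by push_cast; ring
  have a2 : ((n + 2 : ℕ) : ℝ) * w = n * w + w + w := by push_cast; ring
  have a3 : ((N : ℝ) - (n + 2 : ℕ)) * w = (N - (n + 1 : ℕ)) * w - w := by push_cast; ring
  have a4 : ((N : ℝ) - n) * w = (N - (n + 1 : ℕ)) * w + w := by push_cast; ring
  have a5 : (N : ℝ) * w = (n * w + w) + (N - (n + 1 : ℕ)) * w := by push_cast; ring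
  rcases lt_trichotomy (n + 1) c with h | rfl | h
  · have h1 : n ≤ c := by omega
    have h2 : n + 2 ≤ c := by omega
    simp only [greenNumerator, h1, h2, h.le, h.ne, if_true, if_false, a1, a2, sinh_add, cosh_add]
    linear_combination (sinh (n * w) * sinh ((N - c) * w)) * cosh_sq w
  · simp only [greenNumerator, Nat.le_succ, le_refl, if_true,
      show ¬ n + 2 ≤ n + 1 by omega, if_false, a3, a1]
    rw [a5, sinh_sub, sinh_add (n * w + w)]
    have : sinh (n * w) = sinh (n * w + w) * cosh w - cosh (n * w + w) * sinh w := by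
      rw [← sinh_sub]; congr 1; ring
    rw [this]
    ring
  · have h1 : ¬ n + 1 ≤ c := by omega
    have h2 : ¬ n + 2 ≤ c := by omega
    have h3 : greenNumerator N w n c = sinh (c * w) * sinh ((N - n) * w) := by
      rw [greenNumerator]
      split_ifs with h4
      · obtain rfl : n = c := by omega
        rfl
      · rfl
    rw [h3]
    simp only [greenNumerator, h1, h2, h.ne', if_false, a3, a4, sinh_add, sinh_sub]
    ring

theorem tridiag_mul_green {m : ℕ} {s w : ℝ} (hw : 0 < w) (hs : s * (cosh w - 1) = 1) :
    tridiag m (-(s / 2)) (1 + s) (-(s / 2)) * green m w = 1 := by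
  ext i j
  have hm : 0 < sinh (((m : ℝ) + 1) * w) := sinh_pos_iff.2 (by positivity)
  have hsw := sinh_pos_iff.2 hw
  set C := 2 * (cosh w - 1) / (sinh w * sinh ((m + 1) * w)) with hC
  have hrec := greenNumerator_recurrence (m + 1) w i (j + 1)
  have h := sum_tridiag_mul (-(s / 2)) (1 + s)
    (fun n => C * greenNumerator (m + 1) w n (j + 1))
    (by simp [greenNumerator])
    (by simp [greenNumerator, show ¬ m ≤ (j : ℕ) by have := j.2; omega]) i
  have hmul : (tridiag m (-(s / 2)) (1 + s) (-(s / 2)) * green m w) i j =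
      C * (s / 2) * (if (i : ℕ) + 1 = j + 1 then sinh w * sinh ((m + 1 : ℕ) * w) else 0) := by
    rw [Matrix.mul_apply]
    simp only [green, Matrix.of_apply, ← hC]
    rw [h, ← hrec]
    linear_combination C * greenNumerator (m + 1) w (i + 1) (j + 1) * -hs
  rw [hmul, Matrix.one_apply]
  simp only [add_left_inj, Fin.val_inj]
  split_ifs with hij
  · rw [hC]
    push_cast
    field_simp
    linarith
  · simp

/-- The row sums of the Green function solve `M r = 1`, so they are one minus the solution of the
homogeneous recurrence with boundary values one. -/
theorem sum_green {m : ℕ} {s w : ℝ} (hw : 0 < w) (hs : s * (cosh w - 1) = 1) (i : Fin m) :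
    ∑ j, green m w i j =
      1 - cosh ((i + 1) * w - (m + 1) * w / 2) / cosh ((m + 1) * w / 2) := by
  have hc := cosh_pos (((m : ℝ) + 1) * w / 2)
  let g : ℕ → ℝ := fun n => 1 - cosh (n * w - (m + 1) * w / 2) / cosh ((m + 1) * w / 2)
  have h0 : g 0 = 0 := by simp [g, hc.ne']
  have h1 : g (m + 1) = 0 := by
    have : ((m + 1 : ℕ) : ℝ) * w - (m + 1) * w / 2 = (m + 1) * w / 2 := by push_cast; ring
    simp [g, -Nat.cast_add, this, hc.ne']
  -- The constant `1` is mapped to `1` inside, and `cosh` solves the homogeneous recurrence.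
  have hM : Matrix.mulVec (tridiag m (-(s / 2)) (1 + s) (-(s / 2))) (fun k : Fin m => g (k + 1)) =
      fun _ => 1 := by
    ext k
    rw [Matrix.mulVec, dotProduct, sum_tridiag_mul _ _ g h0 h1]
    have b1 : ((k : ℕ) : ℝ) * w - (m + 1) * w / 2 =
      ((k + 1 : ℕ) * w - (m + 1) * w / 2) - w := by push_cast; ring
    have b2 : ((k + 2 : ℕ) : ℝ) * w - (m + 1) * w / 2 =
      ((k + 1 : ℕ) * w - (m + 1) * w / 2) + w := by push_cast; ring
    simp only [g]
    rw [b1, b2]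
    generalize ((k + 1 : ℕ) : ℝ) * w - (m + 1) * w / 2 = y
    rw [cosh_add, cosh_sub]
    linear_combination (cosh y / cosh ((m + 1) * w / 2)) * hs
  have hG := mul_eq_one_comm.1 (tridiag_mul_green (m := m) hw hs)
  have hr : Matrix.mulVec (green m w) (fun _ => 1) = fun k : Fin m => g (k + 1) := by
    rw [← hM, Matrix.mulVec_mulVec, hG, Matrix.one_mulVec]
  have := congrFun hr i
  simpa [Matrix.mulVec, dotProduct, g] using this

theorem crankNicolson_eq {m : ℕ} {s w : ℝ} (hw : 0 < w) (hs : s * (cosh w - 1) = 1) :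
    crankNicolson m s = (2 : ℝ) • green m w - 1 := by
  have h : tridiag m (s / 2) (1 - s) (s / 2) =
      (2 : ℝ) • 1 - tridiag m (-(s / 2)) (1 + s) (-(s / 2)) := by
    ext i j
    simp only [tridiag, Matrix.of_apply, Matrix.sub_apply, Matrix.smul_apply, Matrix.one_apply,
      ← Fin.val_inj]
    split_ifs <;> simp; ring
  rw [crankNicolson, h, Matrix.inv_eq_right_inv (tridiag_mul_green hw hs), mul_sub,
    mul_eq_one_comm.1 (tridiag_mul_green hw hs), mul_smul_comm, mul_one]

theorem green_nonneg {m : ℕ} {w : ℝ} (hw : 0 < w) (i j : Fin m) : 0 ≤ green m w i j := by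
  have hm : 0 < sinh (((m : ℝ) + 1) * w) := sinh_pos_iff.2 (by positivity)
  have hsw := sinh_pos_iff.2 hw
  have hcw := one_lt_cosh.2 hw.ne'
  have hk (k : Fin m) : 0 ≤ sinh (((m + 1 : ℕ) - (k + 1 : ℕ) : ℝ) * w) := by
    refine sinh_nonneg_iff.2 (mul_nonneg (sub_nonneg.2 ?_) hw.le)
    exact_mod_cast (by omega)
  have hk' (k : Fin m) : 0 ≤ sinh (((k + 1 : ℕ) : ℝ) * w) := sinh_nonneg_iff.2 (by positivity)
  rw [green, Matrix.of_apply]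
  refine mul_nonneg (div_nonneg (by linarith) (by positivity)) ?_
  rw [greenNumerator]
  split_ifs
  · exact mul_nonneg (hk' i) (hk j)
  · exact mul_nonneg (hk' j) (hk i)

/-! ### The row sums -/

/-- Since `A = 2 G - I` with `G ≥ 0` and row sums of `G` at most one, the `i`-th absolute row sum
of `A` is at most one if and only if the diagonal entry carries half of the row sum of `G`. -/
theorem sum_abs_crankNicolson_le_one_iff {m : ℕ} {s w : ℝ} (hw : 0 < w)
    (hs : s * (cosh w - 1) = 1) (i : Fin m) :
    ∑ j, |crankNicolson m s i j| ≤ 1 ↔ ∑ j, green m w i j ≤ 2 * green m w i i := by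
  have hle : ∑ j, green m w i j ≤ 1 := by
    rw [sum_green hw hs, sub_le_self_iff]
    exact div_nonneg (cosh_pos _).le (cosh_pos _).le
  have h1 : ∑ j, |crankNicolson m s i j| =
      |2 * green m w i i - 1| + ∑ j ∈ Finset.univ.erase i, 2 * green m w i j := by
    rw [← Finset.add_sum_erase _ _ (Finset.mem_univ i), crankNicolson_eq hw hs]
    congr 1
    · simp
    · refine Finset.sum_congr rfl fun j hj => ?_
      have hji : i ≠ j := (Finset.ne_of_mem_erase hj).symm
      simp [Matrix.one_apply_ne hji, abs_of_nonneg (green_nonneg hw i j)]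
  have h2 := Finset.add_sum_erase Finset.univ (fun j => green m w i j) (Finset.mem_univ i)
  rw [h1, ← Finset.mul_sum]
  -- If `2 G i i ≥ 1`, both sides hold, because the row sum of `G` is at most one.
  rcases abs_cases (2 * green m w i i - 1) with ⟨h, h'⟩ | ⟨h, h'⟩ <;> rw [h]
  · exact ⟨fun _ => by linarith, fun _ => by linarith⟩
  · exact ⟨fun _ => by linarith, fun _ => by linarith⟩

/-- Both sides of the row condition carry the factor
`2 sinh p sinh q cosh p cosh q / (sinh (p + q) cosh (p + q))` with `p = (i + 1) x` and
`q = (m - i) x`; what remains is a condition on hyperbolic tangents. -/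
theorem sum_green_le_iff {m : ℕ} {s x : ℝ} (hx : 0 < x) (hs : s * (cosh (2 * x) - 1) = 1)
    (i : Fin m) :
    ∑ j, green m (2 * x) i j ≤ 2 * green m (2 * x) i i ↔
      tanh ((i + 1 : ℕ) * x) + tanh ((m - i : ℕ) * x) ≤ 4 * tanh x := by
  have hsub : ((m - i : ℕ) : ℝ) = m - i := Nat.cast_sub i.2.le
  have hpR : (0 : ℝ) < (i + 1 : ℕ) := by positivity
  have hqR : (0 : ℝ) < (m - i : ℕ) := by exact_mod_cast Nat.sub_pos_of_lt i.2
  have hp := mul_pos hpR hx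
  have hq := mul_pos hqR hx
  rw [sum_green (mul_pos two_pos hx) hs, green, Matrix.of_apply, greenNumerator, if_pos le_rfl]
  have a1 : ((i : ℕ) + 1 : ℝ) * (2 * x) - (m + 1) * (2 * x) / 2 =
      (i + 1 : ℕ) * x - (m - i : ℕ) * x := by rw [hsub]; push_cast; ring
  have a2 : ((m : ℝ) + 1) * (2 * x) / 2 = (i + 1 : ℕ) * x + (m - i : ℕ) * x := by
    rw [hsub]; push_cast; ring
  have a3 : ((m : ℝ) + 1) * (2 * x) = 2 * ((i + 1 : ℕ) * x + (m - i : ℕ) * x) := by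
    rw [hsub]; push_cast; ring
  have a4 : (((m + 1 : ℕ) : ℝ) - (i + 1 : ℕ)) * (2 * x) = 2 * ((m - i : ℕ) * x) := by
    rw [hsub]; push_cast; ring
  have a5 : ((i + 1 : ℕ) : ℝ) * (2 * x) = 2 * ((i + 1 : ℕ) * x) := by ring
  rw [a1, a2, a3, a4, a5]
  generalize ((i + 1 : ℕ) : ℝ) * x = p at *
  generalize ((m - i : ℕ) : ℝ) * x = q at *
  have hsp := sinh_pos_iff.2 hp
  have hsq := sinh_pos_iff.2 hq
  have hsx := sinh_pos_iff.2 hx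
  have hspq := sinh_pos_iff.2 (add_pos hp hq)
  have hcp := cosh_pos p
  have hcq := cosh_pos q
  have hcx := cosh_pos x
  have hcpq := cosh_pos (p + q)
  have hcw : cosh (2 * x) - 1 = 2 * sinh x ^ 2 := by rw [cosh_two_mul, cosh_sq]; ring
  have hr : 1 - cosh (p - q) / cosh (p + q) =
      2 * sinh p * sinh q * cosh p * cosh q / (sinh (p + q) * cosh (p + q)) *
        (tanh p + tanh q) := by
    have h : tanh p + tanh q = sinh (p + q) / (cosh p * cosh q) := by
      rw [tanh_eq_sinh_div_cosh, tanh_eq_sinh_div_cosh, sinh_add]; field_simp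
    rw [h, one_sub_div hcpq.ne']
    field_simp
    rw [cosh_add, cosh_sub]; ring
  have hd : 2 * (2 * (cosh (2 * x) - 1) / (sinh (2 * x) * sinh (2 * (p + q))) *
      (sinh (2 * p) * sinh (2 * q))) =
      2 * sinh p * sinh q * cosh p * cosh q / (sinh (p + q) * cosh (p + q)) * (4 * tanh x) := by
    rw [hcw, sinh_two_mul, sinh_two_mul, sinh_two_mul, sinh_two_mul, tanh_eq_sinh_div_cosh]
    field_simp
    ring
  rw [hr, hd]
  exact mul_le_mul_iff_right₀ (by positivity)

/-- The middle row decides contractivity. -/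
theorem maxNorm_crankNicolson_le_one_iff {m : ℕ} (hm : 0 < m) {s x : ℝ} (hx : 0 < x)
    (hs : s * (cosh (2 * x) - 1) = 1) :
    maxNorm (crankNicolson m s) ≤ 1 ↔ midTanh (m + 1) x ≤ 4 * tanh x := by
  simp only [maxNorm_le_one_iff, sum_abs_crankNicolson_le_one_iff (mul_pos two_pos hx) hs,
    sum_green_le_iff hx hs]
  -- Row `(m + 1) / 2`, counted from one, is a middle row.
  refine ⟨fun h => ?_, fun h i => (tanh_add_tanh_le_midTanh ?_ hx.le).trans h⟩
  · have := h ⟨(m + 1) / 2 - 1, by omega⟩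
    have e1 : (m + 1) / 2 - 1 + 1 = (m + 1) / 2 := by omega
    have e2 : m - ((m + 1) / 2 - 1) = (m + 1 + 1) / 2 := by omega
    simpa only [midTanh, e1, e2] using this
  · have := i.2
    omega

/-- Every `s > 0` has the form `1 / (cosh w - 1)` with `w = 2 x > 0`. -/
theorem exists_pos_mul_cosh_sub_one {s : ℝ} (hs : 0 < s) :
    ∃ x, 0 < x ∧ s * (cosh (2 * x) - 1) = 1 := by
  refine ⟨arsinh √(1 / (2 * s)), arsinh_pos_iff.2 (sqrt_pos.2 (by positivity)), ?_⟩
  rw [cosh_two_mul, cosh_sq, sinh_arsinh, sq_sqrt (by positivity)]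
  field_simp
  ring

/-! ### The contractivity bounds -/

theorem strictAntiOn_one_div_cosh_sub_one : StrictAntiOn (fun w => 1 / (cosh w - 1)) (Ioi 0) := by
  intro a ha b hb hab
  have h1 := one_lt_cosh.2 (ne_of_gt ha)
  have h2 : cosh a < cosh b := by
    rwa [cosh_lt_cosh, abs_of_pos ha, abs_of_pos hb]
  exact one_div_lt_one_div_of_lt (by linarith) (by linarith)

theorem one_div_cosh_sub_one_criticalFour : 1 / (cosh criticalFour - 1) = 1 + √5 := by
  have h5 : √5 ^ 2 = 5 := sq_sqrt (by norm_num)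
  have h := two_lt_sqrt_five
  rw [cosh_criticalFour, div_eq_iff (by linarith)]
  linear_combination -h5 / 4

theorem one_div_cosh_two_mul_sub_one {x : ℝ} (hx : 0 < x) :
    1 / (cosh (2 * x) - 1) = (1 - tanh x ^ 2) / (2 * tanh x ^ 2) := by
  have hs := sinh_pos_iff.2 hx
  have hc := cosh_pos x
  have h : cosh (2 * x) - 1 = 2 * sinh x ^ 2 := by rw [cosh_two_mul, cosh_sq]; ring
  rw [h, tanh_eq_sinh_div_cosh]
  field_simp
  rw [cosh_sq]; ring

theorem theorem2 :
    -- For `m = 1, 2, 3` the matrix is contractive for every `s > 0`.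
    (∀ m : ℕ, m ∈ ({1, 2, 3} : Set ℕ) → ∀ s : ℝ, 0 < s → maxNorm (crankNicolson m s) ≤ 1) ∧
    ∃ ω sc : ℕ → ℝ,
      -- For `m ≥ 4`, `ω m` is the unique positive root, it lies in the stated interval, and
      -- contractivity holds exactly up to `sc m`.
      (∀ m : ℕ, 4 ≤ m →
        0 < ω m ∧ ContractivityEquation m (ω m) ∧
        (∀ w : ℝ, 0 < w → ContractivityEquation m w → w = ω m) ∧
        ω m ∈ Ico (log ((3 + √5 + √(-2 + 6 * √5)) / 4)) (log 3) ∧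
        sc m = 1 / (cosh (ω m) - 1) ∧
        ∀ s : ℝ, 0 < s → (maxNorm (crankNicolson m s) ≤ 1 ↔ s ≤ sc m)) ∧
      -- The bounds decrease strictly, lie in `(3/2, 1 + √5]` and tend to `3/2`.
      StrictAntiOn sc (Ici 4) ∧
      (∀ m : ℕ, 4 ≤ m → sc m ∈ Ioc (3 / 2) (1 + √5)) ∧
      Tendsto sc atTop (𝓝 (3 / 2)) ∧
      -- Hence contractivity is not preserved when the mesh is refined with `s` kept constant.
      ∀ m : ℕ, 4 ≤ m → ∃ s : ℝ, 0 < s ∧ maxNorm (crankNicolson m s) ≤ 1 ∧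
        ∀ n : ℕ, m < n → 1 < maxNorm (crankNicolson n s) := by
  have hsmall : ∀ m : ℕ, m ∈ ({1, 2, 3} : Set ℕ) → ∀ s : ℝ, 0 < s →
      maxNorm (crankNicolson m s) ≤ 1 := by
    intro m hm s hs
    have hm' : 0 < m ∧ m + 1 ≤ 4 := by
      rcases hm with rfl | rfl | rfl <;> norm_num
    obtain ⟨x, hx, hsx⟩ := exists_pos_mul_cosh_sub_one hs
    exact (maxNorm_crankNicolson_le_one_iff hm'.1 hx hsx).2 (midTanh_le_of_le_four hm'.2 hx)
  refine ⟨hsmall, ?_⟩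
  have hex (m : ℕ) : ∃ x : ℝ, 4 ≤ m →
      x ∈ Ico (criticalFour / 2) (log 3 / 2) ∧ midTanh (m + 1) x = 4 * tanh x := by
    by_cases hm : 4 ≤ m
    · obtain ⟨x, hx⟩ := exists_critical (N := m + 1) (by omega)
      exact ⟨x, fun _ => hx⟩
    · exact ⟨0, fun h => absurd h hm⟩
  -- `c m` is half the critical value `ω m`.
  choose c hc using hex
  have hpos {m : ℕ} (hm : 4 ≤ m) : 0 < c m :=
    (half_pos criticalFour_pos).trans_le (hc m hm).1.1
  have hmono {m n : ℕ} (hm : 4 ≤ m) (hmn : m < n) : c m < c n :=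
    critical_lt_critical (by omega) (by omega) (hpos hm) (hpos (hm.trans hmn.le)) (hc m hm).2
      (hc n (hm.trans hmn.le)).2
  have hanti : StrictAntiOn (fun m => 1 / (cosh (2 * c m) - 1)) (Ici 4) := by
    intro m hm n hn hmn
    exact strictAntiOn_one_div_cosh_sub_one (mul_pos two_pos (hpos hm))
      (mul_pos two_pos (hpos hn)) (mul_lt_mul_of_pos_left (hmono hm hmn) two_pos)
  -- `log 3` and `ω₄` correspond to the end points `3 / 2` and `1 + √5`.
  have hrange (m : ℕ) (hm : 4 ≤ m) : 1 / (cosh (2 * c m) - 1) ∈ Ioc (3 / 2 : ℝ) (1 + √5) := by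
    have h := (hc m hm).1
    have hp : 2 * c m ∈ Ioi (0 : ℝ) := mul_pos two_pos (hpos hm)
    refine ⟨?_, ?_⟩
    · have := strictAntiOn_one_div_cosh_sub_one hp (log_pos (by norm_num : (1 : ℝ) < 3))
        (by linarith [h.2])
      refine lt_of_eq_of_lt ?_ this
      norm_num [cosh_log_three]
    · rw [← one_div_cosh_sub_one_criticalFour]
      exact strictAntiOn_one_div_cosh_sub_one.antitoneOn criticalFour_pos hp (by linarith [h.1])
  have hiff (m : ℕ) (hm : 4 ≤ m) (s : ℝ) (hs : 0 < s) :
      maxNorm (crankNicolson m s) ≤ 1 ↔ s ≤ 1 / (cosh (2 * c m) - 1) := by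
    obtain ⟨x, hx, hsx⟩ := exists_pos_mul_cosh_sub_one hs
    have hne : cosh (2 * x) - 1 ≠ 0 := by rintro h; simp [h] at hsx
    rw [maxNorm_crankNicolson_le_one_iff (by omega) hx hsx,
      midTanh_le_iff (by omega) hx (hpos hm) (hc m hm).2, eq_one_div_of_mul_eq_one_left hsx,
      strictAntiOn_one_div_cosh_sub_one.le_iff_ge (mul_pos two_pos hx)
        (mul_pos two_pos (hpos hm))]
    constructor <;> intro h <;> linarith
  -- At the critical value `4 tanh c = midTanh → 2`.
  have htanh : Tendsto (fun m => tanh (c m)) atTop (𝓝 (1 / 2)) := by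
    have hN : Tendsto (fun m : ℕ => (((m + 1) / 2 : ℕ) : ℝ) * (criticalFour / 2)) atTop atTop := by
      refine Tendsto.atTop_mul_const (half_pos criticalFour_pos)
        (tendsto_natCast_atTop_atTop.comp ?_)
      exact tendsto_atTop_mono (fun m => by omega) (Nat.tendsto_div_const_atTop two_ne_zero)
    have hlow : Tendsto (fun m : ℕ => tanh ((((m + 1) / 2 : ℕ) : ℝ) * (criticalFour / 2)) / 2)
        atTop (𝓝 (1 / 2)) := (tendsto_tanh_atTop_one.comp hN).div_const 2
    refine tendsto_of_tendsto_of_tendsto_of_le_of_le' hlow tendsto_const_nhds ?_ ?_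
    · filter_upwards [eventually_ge_atTop 4] with m hm
      have h1 := two_mul_tanh_le_midTanh (m + 1) (hpos hm).le
      have h2 : tanh ((((m + 1) / 2 : ℕ) : ℝ) * (criticalFour / 2)) ≤
          tanh ((((m + 1) / 2 : ℕ) : ℝ) * c m) :=
        strictMono_tanh.monotone (mul_le_mul_of_nonneg_left (hc m hm).1.1 (by positivity))
      linarith [(hc m hm).2]
    · filter_upwards [eventually_ge_atTop 4] with m hm
      linarith [(hc m hm).2, midTanh_lt_two (m + 1) (c m)]
  -- In terms of `t = tanh (w / 2)`, `1 / (cosh w - 1) = (1 - t ^ 2) / (2 t ^ 2)`.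
  have hlim : Tendsto (fun m => 1 / (cosh (2 * c m) - 1)) atTop (𝓝 (3 / 2)) := by
    have h : Tendsto (fun m => (1 - tanh (c m) ^ 2) / (2 * tanh (c m) ^ 2)) atTop
        (𝓝 ((1 - (1 / 2) ^ 2) / (2 * (1 / 2) ^ 2))) :=
      (tendsto_const_nhds.sub (htanh.pow 2)).div (tendsto_const_nhds.mul (htanh.pow 2))
        (by norm_num)
    norm_num at h
    refine h.congr' ?_
    filter_upwards [eventually_ge_atTop 4] with m hm
    have := one_div_cosh_two_mul_sub_one (hpos hm)
    simp only [one_div] at this ⊢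
    exact this.symm
  refine ⟨fun m => 2 * c m, fun m => 1 / (cosh (2 * c m) - 1), fun m hm => ?_, hanti, hrange, hlim,
    fun m hm => ?_⟩
  · have hp : 0 < 2 * c m := mul_pos two_pos (hpos hm)
    refine ⟨hp, ?_, fun w hw h => ?_, ⟨?_, ?_⟩, rfl, hiff m hm⟩
    · rw [contractivityEquation_iff (by omega) hp, mul_div_cancel_left₀ _ (two_ne_zero (α := ℝ))]
      exact (hc m hm).2
    · have := eq_critical (by omega) (half_pos hw) (hpos hm) (hc m hm).2
        ((contractivityEquation_iff (by omega) hw).1 h)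
      linarith
    · have := (hc m hm).1.1
      rw [criticalFour] at this
      linarith
    · linarith [(hc m hm).1.2]
  · have hs : 0 < 1 / (cosh (2 * c m) - 1) := by linarith [(hrange m hm).1]
    refine ⟨_, hs, (hiff m hm _ hs).2 le_rfl, fun n hn => ?_⟩
    have hn4 : 4 ≤ n := hm.trans hn.le
    rw [← not_le, hiff n hn4 _ hs, not_le]
    exact hanti hm hn4 hn
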